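/- **Setting.** Let $m$ be normalized Lebesgue measure on the unit circle $\mathbb T$, $L^2=L^2(\mathbb T,m)$, $L^\infty=L^\infty(\mathbb T,m)$, $\langle f,g\rangle=\int f\bar g\,dm$, let $z$ be the coordinate function, $H^2\subset L^2$ the Hardy space (vanishing Fourier coefficients of negative index), $H^2_-=\overline{zH^2}=L^2\ominus H^2$, and $M_\varphi$ multiplication by $\varphi$. An inner function is a bounded function with vanishing Fourier coefficients of negative index and with modulus $1$ a.e. on $\mathbb T$. For an inner function $\theta$ (possibly constant) put $K_\theta=H^2\ominus\theta H^2$ and $K_\theta^\perp=L^2\ominus K_\theta=\theta H^2\oplus H^2_-$. Let $P_\theta^\perp$, $P_{\theta H^2}$, $P^-$ be the orthogonal projections of $L^2$ onto $K_\theta^\perp$, $\theta H^2$, $H^2_-$, let $C_\theta f=\theta\bar z\bar f$ for $f\in L^2$, and for $\varphi\in L^\infty$ let $\hat T^\theta_\varphi=P_{\theta H^2}M_{\varphi|\theta H^2}$ and $\check T_\varphi=P^-M_{\varphi|H^2_-}$. For inner functions $\theta,\alpha$ and $\varphi\in L^2$ let $D_\varphi^{\theta,\alpha}f=P_\alpha^\perp(\varphi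 f)$ for $f\in K_\theta^\perp\cap L^\infty$; whenever this map extends to a bounded operator $K_\theta^\perp\to K_\alpha^\perp$, the extension, also denoted by $D_\varphi^{\theta,\alpha}$, is called an asymmetric dual truncated Toeplitz operator. If $\varphi\in L^\infty$, it is $P_\alpha^\perp M_{\varphi|K_\theta^\perp}$. **Theorem.** Let $\theta$ and $\alpha$ be inner functions and let $D\colon K_\theta^\perp\to K_\alpha^\perp$ be a bounded linear operator. Then $D$ is an asymmetric dual truncated Toeplitz operator if and only if the following conditions all hold: 1. $P_{\alpha H^2}D_{|\theta H^2}=\hat T^\alpha_{\bar z}\,P_{\alpha H^2}D_{|\theta H^2}\,\hat T^\theta_z$; 2. $P^-D_{|H^2_-}=(P^-C_\alpha M_{\bar\theta})_{|\theta H^2}\,(P_{\alpha H^2}D_{|\theta H^2})^*\,(M_\theta C_\alpha)_{|H^2_-}$; 3. $P^-D_{|\theta H^2}\,\hat T^\theta_z=\check T_z\,P^-D_{|\theta H^2}$ and $(P_{\alpha H^2}D_{|H^2_-})^*\,\hat T^\alpha_z=\check T_z\,(P_{\alpha H^2}D_{|H^2_-})^*$; 4. $P^-(D(\theta))=P^-\big(\theta\alpha\overline{D^*(\alpha)}\big)$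 and $P^-(D^*(\alpha))=P^-\big(\theta\alpha\overline{D(\theta)}\big)$. In that case the function $$\varphi=\bar\theta\,P_{\alpha H^2}(D(\theta))+\alpha\,\overline{P_{\theta H^2}(D^*(\alpha))}-\alpha\,\overline{\langle D^*(\alpha),\theta\rangle\,\theta}$$ belongs to $L^\infty$, and $D=D_\varphi^{\theta,\alpha}$. -/

import Mathlib

open MeasureTheory
open scoped ENNReal ComplexConjugate

noncomputable section

namespace DualTTO

/-- Normalized Lebesgue measure `m` on the unit circle `𝕋`. The circle is modelled by
`UnitAddCircle = ℝ / ℤ`, the point `t` standing for `z = exp (2 π i t) ∈ 𝕋`. -/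
abbrev m : Measure UnitAddCircle := AddCircle.haarAddCircle

/-- `L² = L²(𝕋, m)`. -/
abbrev L2 : Type := Lp ℂ 2 m

/-- `L^∞ = L^∞(𝕋, m)`. -/
abbrev Linf : Type := Lp ℂ ∞ m

/-- The coordinate function `z` on the circle. -/
def z : Linf := fourierLp ∞ 1

/-- The inclusion `L^∞ ⊆ L²`. -/
def toL2 (φ : Linf) : L2 := ((Lp.memLp φ).mono_exponent le_top).toLp φ

/-- The multiplication operator `M_φ` on `L²`, for `φ ∈ L^∞`. -/
def M (φ : Linf) : L2 →L[ℂ] L2 :=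
  LinearMap.mkContinuous
    { toFun := fun f => φ • f
      map_add' := fun f g => Lp.add_smul φ f g
      map_smul' := fun c f => (Lp.smul_comm c φ f).symm }
    ‖φ‖ (fun f => Lp.norm_smul_le φ f)

lemma M_apply (φ : Linf) (f : L2) : M φ f = φ • f := rfl

lemma coeFn_toL2 (φ : Linf) : toL2 φ =ᵐ[m] φ := MemLp.coeFn_toLp _

lemma coeFn_z : z =ᵐ[m] fourier 1 := coeFn_fourierLp ∞ 1

lemma coeFn_M (φ : Linf) (f : L2) : M φ f =ᵐ[m] fun t => φ t * f t :=
  Lp.coeFn_lpSMul φ f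

lemma coeFn_star {p : ℝ≥0∞} (f : Lp ℂ p m) :
    (star f : Lp ℂ p m) =ᵐ[m] fun t => conj (f t) := AEEqFun.coeFn_star (f : UnitAddCircle →ₘ[m] ℂ)

lemma fourierCoeff_congr {f g : UnitAddCircle → ℂ} (h : f =ᵐ[m] g) (n : ℤ) :
    fourierCoeff f n = fourierCoeff g n := by
  refine integral_congr_ae ?_
  filter_upwards [h] with t ht
  rw [ht]

/-- The Hardy space `H²`: the functions in `L²` whose Fourier coefficients of negative index vanish
(that is, which extend holomorphically to the disc with square summable Taylor coefficients). -/
def H2 : Submodule ℂ L2 where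
  carrier := {f | ∀ n : ℤ, n < 0 → fourierCoeff f n = 0}
  add_mem' := by
    intro f g hf hg n hn
    have h1 := hf n hn
    have h2 := hg n hn
    rw [← fourierBasis_repr] at h1 h2 ⊢
    simp [h1, h2]
  zero_mem' := by
    intro n _
    rw [← fourierBasis_repr]
    simp
  smul_mem' := by
    intro c f hf n hn
    have h1 := hf n hn
    rw [← fourierBasis_repr] at h1 ⊢
    simp [h1]

lemma mem_H2_iff {f : L2} : f ∈ H2 ↔ ∀ n : ℤ, n < 0 → fourierCoeff f n = 0 := Iff.rfl

lemma inner_fourierLp (n : ℤ) (f : L2) : inner ℂ (fourierLp 2 n : L2) f = fourierCoeff f n := by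
  rw [← fourierBasis_repr, HilbertBasis.repr_apply_apply, coe_fourierBasis]

lemma isClosed_H2 : IsClosed (H2 : Set L2) := by
  have : (H2 : Set L2) = ⋂ n : ℤ, ⋂ _ : n < 0, {f : L2 | inner ℂ (fourierLp 2 n : L2) f = 0} := by
    ext f
    simp [mem_H2_iff, inner_fourierLp]
  rw [this]
  refine isClosed_iInter fun n => isClosed_iInter fun _ => ?_
  exact isClosed_eq (by fun_prop) continuous_const

instance : CompleteSpace H2 := isClosed_H2.completeSpace_coe

/-- `H²₋`, the orthogonal complement of `H²` in `L²`; it equals `conj (z H²)`, see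
`mem_H2minus_iff`. -/
abbrev H2minus : Submodule ℂ L2 := H2ᗮ

/-- An inner function, given by its boundary values: an element of `H^∞` (a bounded function whose
Fourier coefficients of negative index vanish) which is unimodular a.e. on the circle.
Constant inner functions are included. -/
structure InnerFunction where
  /-- the boundary function -/
  toLinf : Linf
  norm_eq_one : ∀ᵐ t ∂m, ‖toLinf t‖ = 1
  fourierCoeff_eq_zero : ∀ n : ℤ, n < 0 → fourierCoeff toLinf n = 0

instance : Coe InnerFunction Linf := ⟨InnerFunction.toLinf⟩

/-- The space `θH²`. -/
def thetaH2 (θ : InnerFunction) : Submodule ℂ L2 := H2.map (M θ : L2 →ₗ[ℂ] L2)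

lemma mem_thetaH2_iff {θ : InnerFunction} {f : L2} :
    f ∈ thetaH2 θ ↔ ∃ h ∈ H2, M θ h = f := Iff.rfl

lemma M_star_M (θ : InnerFunction) (f : L2) : M (star (θ : Linf)) (M θ f) = f := by
  apply Lp.ext
  filter_upwards [coeFn_M (star (θ : Linf)) (M θ f), coeFn_M θ f, coeFn_star (θ : Linf),
    θ.norm_eq_one] with t h1 h2 h3 h4
  rw [h1, h2, h3, ← mul_assoc, Complex.conj_mul', h4]
  simp

lemma M_M_star (θ : InnerFunction) (f : L2) : M θ (M (star (θ : Linf)) f) = f := by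
  apply Lp.ext
  filter_upwards [coeFn_M θ (M (star (θ : Linf)) f), coeFn_M (star (θ : Linf)) f,
    coeFn_star (θ : Linf), θ.norm_eq_one] with t h1 h2 h3 h4
  rw [h1, h2, h3, ← mul_assoc, Complex.mul_conj', h4]
  simp

lemma isClosed_thetaH2 (θ : InnerFunction) : IsClosed (thetaH2 θ : Set L2) := by
  have : (thetaH2 θ : Set L2) = M (star (θ : Linf)) ⁻¹' (H2 : Set L2) := by
    ext f
    constructor
    · rintro ⟨h, hh, rfl⟩
      simpa [M_star_M] using hh
    · intro hf
      exact ⟨_, hf, M_M_star θ f⟩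
  rw [this]
  exact isClosed_H2.preimage (M _).continuous

instance (θ : InnerFunction) : CompleteSpace (thetaH2 θ) :=
  (isClosed_thetaH2 θ).completeSpace_coe

/-- The model space `K_θ = H² ⊖ θH²` (it is `{0}` if `θ` is constant). -/
def K (θ : InnerFunction) : Submodule ℂ L2 := H2 ⊓ (thetaH2 θ)ᗮ

/-- The orthogonal complement `K_θ^⊥` of the model space in `L²`. -/
abbrev Kperp (θ : InnerFunction) : Submodule ℂ L2 := (K θ)ᗮ

lemma thetaH2_le_Kperp (θ : InnerFunction) : thetaH2 θ ≤ Kperp θ :=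
  (Submodule.le_orthogonal_orthogonal _).trans (Submodule.orthogonal_le inf_le_right)

lemma H2minus_le_Kperp (θ : InnerFunction) : H2minus ≤ Kperp θ :=
  Submodule.orthogonal_le inf_le_left

lemma fourierLp_mem_H2 {n : ℤ} (hn : 0 ≤ n) : (fourierLp 2 n : L2) ∈ H2 := by
  intro k hk
  rw [← inner_fourierLp]
  exact orthonormal_fourier.2 (by omega)

lemma mem_orthogonal_iff {f : L2} :
    f ∈ H2minus ↔ ∀ n : ℤ, 0 ≤ n → fourierCoeff f n = 0 := by
  constructor
  · intro hf n hn
    rw [← inner_fourierLp]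
    exact hf _ (fourierLp_mem_H2 hn)
  · intro hf g hg
    rw [← fourierBasis.tsum_inner_mul_inner g f]
    refine (tsum_congr fun n => ?_).trans tsum_zero
    rw [coe_fourierBasis, inner_fourierLp, ← inner_conj_symm, inner_fourierLp]
    rcases lt_or_ge n 0 with hn | hn
    · rw [hg n hn]; simp
    · rw [hf n hn]; simp

lemma fourierCoeff_star_mul_star (f : L2) (n : ℤ) :
    fourierCoeff (M (star z) (star f)) n = conj (fourierCoeff f (-n - 1)) := by
  unfold fourierCoeff
  rw [← integral_conj]
  refine integral_congr_ae ?_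
  filter_upwards [coeFn_M (star z) (star f), coeFn_star z, coeFn_star f, coeFn_z]
    with t h1 h2 h3 h4
  rw [h1, h2, h3, h4, ← fourier_neg, smul_eq_mul, smul_eq_mul, map_mul, ← fourier_neg, ← mul_assoc,
    ← fourier_add]
  congr 3
  ring

/-- `J f = z̄ f̄` maps `H²₋` into `H²`. -/
lemma star_mul_star_mem_H2 {f : L2} (hf : f ∈ H2minus) : M (star z) (star f) ∈ H2 := by
  intro n hn
  rw [fourierCoeff_star_mul_star, mem_orthogonal_iff.1 hf _ (by omega), map_zero]

/-- `J f = z̄ f̄` maps `H²` into `H²₋`. -/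
lemma star_mul_star_mem_H2minus {f : L2} (hf : f ∈ H2) : M (star z) (star f) ∈ H2minus := by
  rw [mem_orthogonal_iff]
  intro n hn
  rw [fourierCoeff_star_mul_star, hf _ (by omega), map_zero]

lemma star_z_mul (h : L2) : star (M z h) = M (star z) (star h) := by
  apply Lp.ext
  filter_upwards [coeFn_star (M z h), coeFn_M z h, coeFn_M (star z) (star h), coeFn_star z,
    coeFn_star h] with t h1 h2 h3 h4 h5
  rw [h1, h2, h3, h4, h5, map_mul]

lemma J_J (f : L2) : M (star z) (star (M (star z) (star f))) = f := by
  apply Lp.ext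
  filter_upwards [coeFn_M (star z) (star (M (star z) (star f))), coeFn_star (M (star z) (star f)),
    coeFn_M (star z) (star f), coeFn_star z, coeFn_star f, coeFn_z] with t h1 h2 h3 h4 h5 h6
  rw [h1, h2, h3, h4, h5, h6, map_mul, Complex.conj_conj, Complex.conj_conj, ← mul_assoc,
    ← fourier_neg, ← fourier_add]
  simp

/-- `H²₋ = conj (z H²)`. -/
lemma mem_H2minus_iff {f : L2} : f ∈ H2minus ↔ ∃ h ∈ H2, f = star (M z h) := by
  constructor
  · intro hf
    exact ⟨_, star_mul_star_mem_H2 hf, by rw [star_z_mul, J_J]⟩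
  · rintro ⟨h, hh, rfl⟩
    rw [star_z_mul]
    exact star_mul_star_mem_H2minus hh

/-- An inner function maps `H²` into itself. -/
lemma M_mem_H2 (θ : InnerFunction) {h : L2} (hh : h ∈ H2) : M θ h ∈ H2 := by
  have hs := ((hasSum_fourier_series_L2 h).mapL (M θ))
  refine isClosed_H2.mem_of_tendsto hs (Filter.Eventually.of_forall fun s => ?_)
  refine H2.sum_mem fun n _ => ?_
  rcases lt_or_ge n 0 with hn | hn
  · simp [hh n hn]
  · rw [map_smul]
    refine H2.smul_mem _ ?_
    intro k hk
    rw [← θ.fourierCoeff_eq_zero (k - n) (by omega)]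
    refine integral_congr_ae ?_
    filter_upwards [coeFn_M θ (fourierLp 2 n), coeFn_fourierLp 2 n] with t h1 h2
    rw [h1, h2, smul_eq_mul, smul_eq_mul, mul_left_comm, ← fourier_add, mul_comm]
    congr 3
    ring

/-- The conjugation `C_θ f = θ z̄ f̄` on `L²`. -/
def C (θ : InnerFunction) (f : L2) : L2 := M θ (M (star z) (star f))

/-- `M_θ C_α` maps `H²₋` into `αH²`. -/
lemma M_C_mem (θ α : InnerFunction) {f : L2} (hf : f ∈ H2minus) : M θ (C α f) ∈ thetaH2 α := by
  refine ⟨_, M_mem_H2 θ (star_mul_star_mem_H2 hf), ?_⟩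
  apply Lp.ext
  set g := M (star z) (star f) with hg
  filter_upwards [coeFn_M θ (C α f), coeFn_M α g, coeFn_M α (M θ g), coeFn_M θ g] with t h1 h2 h3 h4
  change (M α (M θ g)) t = _
  rw [h3, h4, h1]
  change _ = _ * (M α g) t
  rw [h2]
  ring

/-- The map `(M_θ C_α)|_{H²₋} : H²₋ → αH²`. -/
def MC (θ α : InnerFunction) (f : H2minus) : thetaH2 α := ⟨M θ (C α f), M_C_mem θ α f.2⟩

/-- The inner function `θ` itself, as an element of `θH² ⊆ L²`. -/
lemma toL2_mem_thetaH2 (θ : InnerFunction) : toL2 θ ∈ thetaH2 θ := by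
  refine ⟨fourierLp 2 0, fourierLp_mem_H2 le_rfl, ?_⟩
  apply Lp.ext
  have h0 : (fourierLp 2 0 : L2) =ᵐ[m] fourier 0 := coeFn_fourierLp 2 0
  filter_upwards [coeFn_M θ (fourierLp 2 0), h0, coeFn_toL2 θ] with t h1 h2 h3
  change (M θ (fourierLp 2 0)) t = _
  rw [h1, h2, h3]
  simp

/-- The function `θ` as an element of `K_θ^⊥`. -/
def self (θ : InnerFunction) : Kperp θ := ⟨toL2 θ, thetaH2_le_Kperp θ (toL2_mem_thetaH2 θ)⟩

/-- For subspaces `S ⊆ V` and `T` of `L²`, the compression `P_T A|_S : S → T` of an operator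
`A : V → W`. -/
def compress {V W : Submodule ℂ L2} (A : V →L[ℂ] W) (S T : Submodule ℂ L2)
    [T.HasOrthogonalProjection] (hS : S ≤ V) : S →L[ℂ] T :=
  T.orthogonalProjectionOnto ∘L W.subtypeL ∘L A ∘L (S.subtypeL.codRestrict V fun f => hS f.2)

/-- `P_T M_φ|_S : S → T`, for `φ ∈ L^∞`. -/
def compressM (φ : Linf) (S T : Submodule ℂ L2) [T.HasOrthogonalProjection] : S →L[ℂ] T :=
  T.orthogonalProjectionOnto ∘L M φ ∘L S.subtypeL

/-- `T̂_φ^θ = P_{θH²} M_φ|_{θH²}`. -/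
abbrev hatT (θ : InnerFunction) (φ : Linf) : thetaH2 θ →L[ℂ] thetaH2 θ :=
  compressM φ (thetaH2 θ) (thetaH2 θ)

/-- `Ť_φ = P⁻ M_φ|_{H²₋}`. -/
abbrev checkT (φ : Linf) : H2minus →L[ℂ] H2minus := compressM φ H2minus H2minus

/-- `D_φ^{θ,α} = P_α^⊥ M_φ|_{K_θ^⊥}` for a bounded symbol `φ`. -/
abbrev dualTT (θ α : InnerFunction) (φ : Linf) : Kperp θ →L[ℂ] Kperp α :=
  compressM φ (Kperp θ) (Kperp α)

/-- `D ∈ 𝒯(K_θ^⊥, K_α^⊥)`: the bounded operator `D` is an asymmetric dual truncated Toeplitz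
operator, i.e. there is a symbol `φ ∈ L²` such that `D` extends the operator
`f ↦ P_α^⊥ (φ f)`, `f ∈ K_θ^⊥ ∩ L^∞`. -/
def IsADTTO {θ α : InnerFunction} (D : Kperp θ →L[ℂ] Kperp α) : Prop :=
  ∃ φ : L2, ∀ (f : Linf) (hf : toL2 f ∈ Kperp θ),
    D ⟨toL2 f, hf⟩ = (Kperp α).orthogonalProjectionOnto (φ • f : L2)

section blocks

variable {θ α : InnerFunction} (D : Kperp θ →L[ℂ] Kperp α)

/-- `P_{αH²} D|_{θH²}`. -/
def block11 : thetaH2 θ →L[ℂ] thetaH2 α := compress D (thetaH2 θ) (thetaH2 α) (thetaH2_le_Kperp θ)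

/-- `P_{αH²} D|_{H²₋}`. -/
def block12 : H2minus →L[ℂ] thetaH2 α := compress D H2minus (thetaH2 α) (H2minus_le_Kperp θ)

/-- `P⁻ D|_{θH²}`. -/
def block21 : thetaH2 θ →L[ℂ] H2minus := compress D (thetaH2 θ) H2minus (thetaH2_le_Kperp θ)

/-- `P⁻ D|_{H²₋}`. -/
def block22 : H2minus →L[ℂ] H2minus := compress D H2minus H2minus (H2minus_le_Kperp θ)

end blocks

/-- The orthogonal projection `P⁻` of `L²` onto `H²₋`, as an operator on `L²`. -/
abbrev Pminus (f : L2) : L2 := H2minus.starProjection f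

/-- The orthogonal projection `P_{θH²}` of `L²` onto `θH²`, as an operator on `L²`. -/
abbrev Ptheta (θ : InnerFunction) (f : L2) : L2 := (thetaH2 θ).starProjection f

end DualTTO

end

/-!
The operator `D` is studied through the sesquilinear form `⟨v, D u⟩`, `u ∈ K_θ^⊥`, `v ∈ K_α^⊥`,
cut into four blocks by `K_θ^⊥ = θH² ⊕ H²₋` and `K_α^⊥ = αH² ⊕ H²₋`. Tested against vectors, the four
conditions become, for `u ∈ θH²`, `v ∈ αH²`, `f, g ∈ H²₋`, the identities

* `⟨v, D u⟩ = ⟨z v, D (z u)⟩`;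
* `⟨g, D f⟩ = ⟨θ C_α f, D (θ C_α g)⟩`;
* `⟨g, D (z u)⟩ = ⟨z̄ g, D u⟩` and `⟨z v, D g⟩ = ⟨v, D (z̄ g)⟩`;
* `⟨g, D θ⟩ = ⟨α, D (θ α ḡ)⟩` and `⟨α, D g⟩ = ⟨θ α ḡ, D θ⟩`,

each of which holds trivially when `D` acts as multiplication by a bounded function `φ`. Conversely,
the first says that `f ↦ ᾱ D (θ f)` compresses to an operator on `H²` with a Toeplitz matrix, so that
the Brown–Halmos theorem (`exists_symbol_of_toeplitz`) yields a bounded `φ` representing the block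
`θH² → αH²`. The second identity carries `φ` over to the block `H²₋ → H²₋`, the fourth carries it to
the vectors `D θ` and `D* α`, and the third propagates it from there along `θ zⁿ` and `α zⁿ` to the
two mixed blocks (`exists_eq_dualTT_of_inner_eq`).

That a symbol in `L²` of a bounded operator is automatically bounded, for Toeplitz operators and for
asymmetric dual truncated Toeplitz operators alike, is `exists_toL2_eq_of_toeplitz`: conjugating with
powers of the shift gives `|∫ ψ p q̄| ≤ C ‖p‖ ‖q‖` for trigonometric polynomials, then by density for
bounded functions, in particular for the indicator function of a set where `|ψ|` is large.

Finally, with `χ = ᾱ θ φ` the formula for the symbol says that `χ` is the sum of its analytic part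
and the conjugate of the analytic part of `χ̄`, with the constant term counted once
(`starProjection_add_star_sub`).
-/

namespace DualTTO

open ContinuousLinearMap (adjoint)

/-! ### Multiplication operators, the Fourier basis and the decomposition of `K_θ^⊥` -/

lemma M_comm (φ ψ : Linf) (f : L2) : M φ (M ψ f) = M ψ (M φ f) := by
  apply Lp.ext
  filter_upwards [coeFn_M φ (M ψ f), coeFn_M ψ f, coeFn_M ψ (M φ f), coeFn_M φ f]
    with t h1 h2 h3 h4
  rw [h1, h2, h3, h4, mul_left_comm]

lemma star_M (φ : Linf) (f : L2) : star (M φ f) = M (star φ) (star f) := by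
  apply Lp.ext
  filter_upwards [coeFn_star (M φ f), coeFn_M φ f, coeFn_M (star φ) (star f), coeFn_star φ,
    coeFn_star f] with t h1 h2 h3 h4 h5
  rw [h1, h2, h3, h4, h5, map_mul]

lemma inner_M_left (φ : Linf) (f g : L2) :
    inner ℂ (M φ f) g = inner ℂ f (M (star φ) g) := by
  rw [L2.inner_def, L2.inner_def]
  refine integral_congr_ae ?_
  filter_upwards [coeFn_M φ f, coeFn_M (star φ) g, coeFn_star φ] with t h1 h2 h3
  rw [h1, h2, h3]
  simp only [RCLike.inner_apply, map_mul]
  ring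

lemma inner_M_right (φ : Linf) (f g : L2) :
    inner ℂ f (M φ g) = inner ℂ (M (star φ) f) g := by
  rw [inner_M_left, star_star]

lemma inner_star_star (f g : L2) : inner ℂ (star f) (star g) = inner ℂ g f := by
  rw [L2.inner_def, L2.inner_def]
  refine integral_congr_ae ?_
  filter_upwards [coeFn_star f, coeFn_star g] with t h1 h2
  rw [h1, h2]
  simp only [RCLike.inner_apply, Complex.conj_conj]
  ring

lemma M_toL2_comm (φ ψ : Linf) : M φ (toL2 ψ) = M ψ (toL2 φ) := by
  apply Lp.ext
  filter_upwards [coeFn_M φ (toL2 ψ), coeFn_M ψ (toL2 φ), coeFn_toL2 φ, coeFn_toL2 ψ]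
    with t h1 h2 h3 h4
  rw [h1, h2, h3, h4, mul_comm]

lemma toL2_M (φ ψ : Linf) : toL2 (φ • ψ : Linf) = M φ (toL2 ψ) := by
  apply Lp.ext
  filter_upwards [coeFn_toL2 (φ • ψ : Linf), coeFn_M φ (toL2 ψ), coeFn_toL2 ψ,
    Lp.coeFn_lpSMul (r := ∞) φ ψ] with t h1 h2 h3 h4
  rw [h1, h2, h3, h4, Pi.smul_apply', smul_eq_mul]

lemma M_lpSMul (φ ψ : Linf) (f : L2) : M (φ • ψ : Linf) f = M φ (M ψ f) := by
  apply Lp.ext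
  filter_upwards [coeFn_M (φ • ψ : Linf) f, coeFn_M φ (M ψ f), coeFn_M ψ f,
    Lp.coeFn_lpSMul (r := ∞) φ ψ] with t h1 h2 h3 h4
  rw [h1, h2, h3, h4, Pi.smul_apply', smul_eq_mul, mul_assoc]

/-- For `ψ ∈ L²` and `f ∈ L^∞`, the product `ψ f` can be read as `M_f ψ`. -/
lemma lpSMul_eq_M (ψ : L2) (f : Linf) : (ψ • f : L2) = M f ψ := by
  apply Lp.ext
  filter_upwards [Lp.coeFn_lpSMul (r := 2) ψ f, coeFn_M f ψ] with t h1 h2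
  rw [h1, h2, Pi.smul_apply', smul_eq_mul, mul_comm]

lemma toL2_add (φ ψ : Linf) : toL2 (φ + ψ) = toL2 φ + toL2 ψ := by
  apply Lp.ext
  filter_upwards [coeFn_toL2 (φ + ψ), coeFn_toL2 φ, coeFn_toL2 ψ, Lp.coeFn_add φ ψ,
    Lp.coeFn_add (toL2 φ) (toL2 ψ)] with t h1 h2 h3 h4 h5
  rw [h1, h4, h5, Pi.add_apply, Pi.add_apply, h2, h3]

lemma toL2_smul (c : ℂ) (φ : Linf) : toL2 (c • φ) = c • toL2 φ := by
  apply Lp.ext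
  filter_upwards [coeFn_toL2 (c • φ), coeFn_toL2 φ, Lp.coeFn_smul c φ,
    Lp.coeFn_smul c (toL2 φ)] with t h1 h2 h3 h4
  rw [h1, h3, h4, Pi.smul_apply, Pi.smul_apply, h2]

lemma star_const_smul (c : ℂ) (f : L2) : star (c • f) = conj c • star f := by
  apply Lp.ext
  filter_upwards [coeFn_star (c • f), Lp.coeFn_smul c f, coeFn_star f,
    Lp.coeFn_smul (conj c) (star f)] with t h1 h2 h3 h4
  rw [h1, h2, h4, Pi.smul_apply, Pi.smul_apply, h3, smul_eq_mul, smul_eq_mul, map_mul]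

lemma M_add_left (φ ψ : Linf) (f : L2) : M (φ + ψ) f = M φ f + M ψ f :=
  Lp.smul_add φ ψ f

lemma M_smul_left (c : ℂ) (φ : Linf) (f : L2) : M (c • φ) f = c • M φ f :=
  Lp.smul_assoc c φ f

lemma toL2_fourierLp (n : ℤ) : toL2 (fourierLp ∞ n) = fourierLp 2 n := by
  have h1 : (fourierLp ∞ n : Linf) =ᵐ[m] fourier n := coeFn_fourierLp ∞ n
  have h2 : (fourierLp 2 n : L2) =ᵐ[m] fourier n := coeFn_fourierLp 2 n
  apply Lp.ext
  filter_upwards [coeFn_toL2 (fourierLp ∞ n), h1, h2] with t h3 h4 h5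
  rw [h3, h4, h5]

lemma star_fourierLp_top (n : ℤ) : star (fourierLp ∞ n : Linf) = fourierLp ∞ (-n) := by
  have h1 : ∀ k, (fourierLp ∞ k : Linf) =ᵐ[m] fourier k := coeFn_fourierLp ∞
  apply Lp.ext
  filter_upwards [coeFn_star (fourierLp ∞ n : Linf), h1 n, h1 (-n)] with t h3 h4 h5
  rw [h3, h4, h5, fourier_neg]

lemma star_fourierLp_two (n : ℤ) : star (fourierLp 2 n : L2) = fourierLp 2 (-n) := by
  have h1 : ∀ k, (fourierLp 2 k : L2) =ᵐ[m] fourier k := coeFn_fourierLp 2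
  apply Lp.ext
  filter_upwards [coeFn_star (fourierLp 2 n : L2), h1 n, h1 (-n)] with t h3 h4 h5
  rw [h3, h4, h5, fourier_neg]

lemma M_fourierLp_fourierLp (k n : ℤ) :
    M (fourierLp ∞ k) (fourierLp 2 n) = fourierLp 2 (k + n) := by
  have h1 : ∀ k, (fourierLp 2 k : L2) =ᵐ[m] fourier k := coeFn_fourierLp 2
  have h2 : (fourierLp ∞ k : Linf) =ᵐ[m] fourier k := coeFn_fourierLp ∞ k
  apply Lp.ext
  filter_upwards [coeFn_M (fourierLp ∞ k) (fourierLp 2 n), h1 n, h1 (k + n), h2] with t h3 h4 h5 h6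
  rw [h3, h4, h5, h6, fourier_add]

lemma star_z : star z = fourierLp ∞ (-1) := star_fourierLp_top 1

lemma M_z_fourierLp (n : ℤ) : M z (fourierLp 2 n) = fourierLp 2 (n + 1) := by
  rw [z, M_fourierLp_fourierLp, add_comm]

lemma M_fourierLp_zero (φ : Linf) : M φ (fourierLp 2 0) = toL2 φ := by
  rw [← toL2_fourierLp, M_toL2_comm]
  have h2 : (fourierLp ∞ 0 : Linf) =ᵐ[m] fourier 0 := coeFn_fourierLp ∞ 0
  apply Lp.ext
  filter_upwards [coeFn_M (fourierLp ∞ 0) (toL2 φ), h2] with t h3 h4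
  rw [h3, h4, fourier_zero, one_mul]

lemma toL2_star (φ : Linf) : toL2 (star φ) = star (toL2 φ) := by
  rw [← M_fourierLp_zero, ← M_fourierLp_zero, star_M, star_fourierLp_two, neg_zero]

/-- Multiplication by a power of the coordinate function shifts the Fourier coefficients. -/
lemma fourierCoeff_M_fourierLp (k : ℤ) (f : L2) (n : ℤ) :
    fourierCoeff (M (fourierLp ∞ k) f) n = fourierCoeff f (n - k) := by
  rw [← inner_fourierLp, inner_M_right, star_fourierLp_top, M_fourierLp_fourierLp,
    inner_fourierLp, neg_add_eq_sub]

lemma fourierCoeff_star (f : L2) (n : ℤ) :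
    fourierCoeff (star f : L2) n = conj (fourierCoeff f (-n)) := by
  rw [← inner_fourierLp, ← inner_fourierLp, inner_conj_symm, ← inner_star_star, star_star,
    star_fourierLp_two]

lemma M_star_M_fourierLp (k : ℤ) (f : L2) :
    M (star (fourierLp ∞ k)) (M (fourierLp ∞ k) f) = f := by
  apply (fourierBasis (T := 1)).repr.injective
  ext n
  rw [fourierBasis_repr, fourierBasis_repr, star_fourierLp_top, fourierCoeff_M_fourierLp,
    fourierCoeff_M_fourierLp]
  congr 1
  ring

lemma norm_M_fourierLp (k : ℤ) (f : L2) : ‖M (fourierLp ∞ k) f‖ = ‖f‖ := by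
  rw [@norm_eq_sqrt_re_inner ℂ, inner_M_left, M_star_M_fourierLp, ← norm_eq_sqrt_re_inner]

lemma M_star_z_M_z (f : L2) : M (star z) (M z f) = f := M_star_M_fourierLp 1 f

lemma M_z_M_star_z (f : L2) : M z (M (star z) f) = f := by
  rw [M_comm, M_star_z_M_z]

lemma inner_M_M (θ : InnerFunction) (f g : L2) :
    inner ℂ (M θ f) (M θ g) = inner ℂ f g := by
  rw [inner_M_left, M_star_M]

lemma ext_fourierCoeff {f g : L2} (h : ∀ n, fourierCoeff f n = fourierCoeff g n) : f = g := by
  apply (fourierBasis (T := 1)).repr.injective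
  ext n
  rw [fourierBasis_repr, fourierBasis_repr, h]

lemma fourierCoeff_add (f g : L2) (n : ℤ) :
    fourierCoeff (f + g : L2) n = fourierCoeff f n + fourierCoeff g n := by
  simp only [← inner_fourierLp, inner_add_right]

lemma fourierCoeff_sub (f g : L2) (n : ℤ) :
    fourierCoeff (f - g : L2) n = fourierCoeff f n - fourierCoeff g n := by
  simp only [← inner_fourierLp, inner_sub_right]

lemma fourierLp_mem_H2minus {n : ℤ} (hn : n < 0) : (fourierLp 2 n : L2) ∈ H2minus := by
  rw [mem_orthogonal_iff]
  intro k hk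
  rw [← inner_fourierLp]
  exact orthonormal_fourier.2 (by omega)

/-- A continuous linear map vanishing on `1, z, z², …` vanishes on `H²`. -/
lemma eq_zero_of_mem_H2 {F : Type*} [NormedAddCommGroup F] [NormedSpace ℂ F] (A : L2 →L[ℂ] F)
    (hA : ∀ n : ℤ, 0 ≤ n → A (fourierLp 2 n) = 0) {f : L2} (hf : f ∈ H2) : A f = 0 := by
  have hs := (hasSum_fourier_series_L2 f).mapL A
  refine hs.unique ?_
  convert hasSum_zero with n
  rcases lt_or_ge n 0 with hn | hn
  · simp [hf n hn]
  · rw [map_smul, hA n hn, smul_zero]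

lemma eq_zero_of_mem_H2minus {F : Type*} [NormedAddCommGroup F] [NormedSpace ℂ F]
    (A : L2 →L[ℂ] F) (hA : ∀ n : ℤ, n < 0 → A (fourierLp 2 n) = 0) {f : L2} (hf : f ∈ H2minus) :
    A f = 0 := by
  have hs := (hasSum_fourier_series_L2 f).mapL A
  refine hs.unique ?_
  convert hasSum_zero with n
  rcases lt_or_ge n 0 with hn | hn
  · rw [map_smul, hA n hn, smul_zero]
  · simp [mem_orthogonal_iff.1 hf n hn]

lemma M_z_mem_H2 {f : L2} (hf : f ∈ H2) : M z f ∈ H2 := by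
  intro n hn
  rw [z, fourierCoeff_M_fourierLp]
  exact hf _ (by omega)

lemma M_star_z_mem_H2minus {f : L2} (hf : f ∈ H2minus) : M (star z) f ∈ H2minus := by
  rw [mem_orthogonal_iff]
  intro n hn
  rw [star_z, fourierCoeff_M_fourierLp]
  exact mem_orthogonal_iff.1 hf _ (by omega)

lemma M_z_mem_thetaH2 {θ : InnerFunction} {f : L2} (hf : f ∈ thetaH2 θ) : M z f ∈ thetaH2 θ := by
  obtain ⟨h, hh, rfl⟩ := hf
  exact ⟨M z h, M_z_mem_H2 hh, M_comm _ _ _⟩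

lemma thetaH2_le_H2 (θ : InnerFunction) : thetaH2 θ ≤ H2 := by
  rintro _ ⟨h, hh, rfl⟩
  exact M_mem_H2 θ hh

lemma fourierCoeff_starProjection_H2_of_nonneg (f : L2) {n : ℤ} (hn : 0 ≤ n) :
    fourierCoeff (H2.starProjection f) n = fourierCoeff f n := by
  have h1 := mem_orthogonal_iff.1 (H2.sub_starProjection_mem_orthogonal f) n hn
  rw [fourierCoeff_sub, sub_eq_zero] at h1
  exact h1.symm

lemma fourierCoeff_starProjection_H2_of_neg (f : L2) {n : ℤ} (hn : n < 0) :
    fourierCoeff (H2.starProjection f) n = 0 :=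
  H2.starProjection_apply_mem f n hn

/-- The conjugate of a function in `H²₋` is in `H²`. -/
lemma star_mem_H2 {g : L2} (hg : g ∈ H2minus) : star g ∈ H2 := by
  intro n hn
  rw [fourierCoeff_star, mem_orthogonal_iff.1 hg _ (by omega), map_zero]

/-- The decomposition `K_θ^⊥ = θH² ⊕ H²₋`. -/
lemma exists_of_mem_Kperp {θ : InnerFunction} {f : L2} (hf : f ∈ Kperp θ) :
    ∃ u ∈ thetaH2 θ, ∃ g ∈ H2minus, f = u + g := by
  set a := H2.starProjection f with ha
  set u := (thetaH2 θ).starProjection a with hu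
  have hu' : u ∈ thetaH2 θ := Submodule.starProjection_apply_mem _ _
  have hg : f - a ∈ H2minus := Submodule.sub_starProjection_mem_orthogonal _
  have hr : a - u ∈ K θ :=
    ⟨H2.sub_mem (Submodule.starProjection_apply_mem _ _) (thetaH2_le_H2 θ hu'),
      Submodule.sub_starProjection_mem_orthogonal _⟩
  have hr' : a - u ∈ Kperp θ := by
    have : a - u = f - (f - a) - u := by abel
    rw [this]
    exact Submodule.sub_mem _ (Submodule.sub_mem _ hf (H2minus_le_Kperp θ hg))
      (thetaH2_le_Kperp θ hu')
  have h0 : a - u = 0 := inner_self_eq_zero.1 (hr' _ hr)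
  exact ⟨u, hu', f - a, hg, by rw [← sub_eq_zero.1 h0]; abel⟩

/-! ### Boundedness of symbols and the Brown–Halmos theorem -/

/-- A function `ψ ∈ L²` for which `‖q ψ‖ ≤ C ‖q‖` for all bounded `q` is itself bounded. -/
lemma exists_toL2_eq_of_norm_M_le (ψ : L2) (C : ℝ)
    (h : ∀ q : Linf, ‖M q ψ‖ ≤ C * ‖toL2 q‖) : ∃ Ψ : Linf, toL2 Ψ = ψ := by
  -- Test the bound on the indicator function of the set where `|ψ| ≥ |C| + 1`.
  set E : Set UnitAddCircle := {t | |C| + 1 ≤ ‖ψ t‖} with hE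
  have hEm : MeasurableSet E :=
    measurableSet_le measurable_const (Lp.stronglyMeasurable ψ).measurable.norm
  set q : Linf := indicatorConstLp ∞ hEm (measure_ne_top m E) (1 : ℂ) with hq
  have hq1 : q =ᵐ[m] E.indicator fun _ => (1 : ℂ) := indicatorConstLp_coeFn
  have h1 : ‖((|C| + 1 : ℝ) : ℂ) • toL2 q‖ ≤ ‖M q ψ‖ := by
    apply Lp.norm_le_norm_of_ae_le
    filter_upwards [Lp.coeFn_smul ((|C| + 1 : ℝ) : ℂ) (toL2 q), coeFn_toL2 q, hq1, coeFn_M q ψ]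
      with t h1 h2 h3 h4
    rw [h1, h4, Pi.smul_apply, h2, h3]
    by_cases ht : t ∈ E
    · rw [Set.indicator_of_mem ht, smul_eq_mul, mul_one, one_mul, Complex.norm_real,
        Real.norm_of_nonneg (by positivity)]
      exact ht
    · simp [Set.indicator_of_notMem ht]
  have h2 : (|C| + 1) * ‖toL2 q‖ ≤ C * ‖toL2 q‖ := by
    rw [norm_smul, Complex.norm_real, Real.norm_of_nonneg (by positivity)] at h1
    exact h1.trans (h q)
  have h3 : toL2 q = 0 := by
    rw [← norm_eq_zero]
    nlinarith [norm_nonneg (toL2 q), le_abs_self C]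
  have h4 : ∀ᵐ t ∂m, ‖ψ t‖ ≤ |C| + 1 := by
    have h5 : toL2 q =ᵐ[m] 0 := by rw [h3]; exact Lp.coeFn_zero _ _ _
    filter_upwards [h5, coeFn_toL2 q, hq1] with t h6 h7 h8
    by_contra! h9
    have ht : t ∈ E := h9.le
    rw [h6, h8, Set.indicator_of_mem ht] at h7
    simp at h7
  have h5 : MemLp ψ ∞ m := memLp_top_of_bound (Lp.aestronglyMeasurable ψ) _ h4
  refine ⟨h5.toLp ψ, ?_⟩
  apply Lp.ext
  filter_upwards [coeFn_toL2 (h5.toLp ψ), h5.coeFn_toLp] with t h6 h7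
  rw [h6, h7]

/-- The norm of a vector of `L²` is determined by its pairings with trigonometric polynomials. -/
lemma norm_le_of_trigPoly (u : L2) {c : ℝ} (hc : 0 ≤ c)
    (h : ∀ p ∈ Submodule.span ℂ (Set.range fun n : ℤ => (fourierLp ∞ n : Linf)),
      ‖(inner ℂ u (toL2 p) : ℂ)‖ ≤ c * ‖toL2 p‖) : ‖u‖ ≤ c := by
  rw [← innerSL_apply_norm ℂ u]
  refine ContinuousLinearMap.opNorm_le_bound _ hc fun f => ?_
  have hcl : IsClosed {f : L2 | ‖innerSL ℂ u f‖ ≤ c * ‖f‖} :=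
    isClosed_le (by fun_prop) (by fun_prop)
  let S : Submodule ℂ L2 := Submodule.map
    ({ toFun := toL2, map_add' := toL2_add, map_smul' := toL2_smul } : Linf →ₗ[ℂ] L2)
    (Submodule.span ℂ (Set.range fun n : ℤ => (fourierLp ∞ n : Linf)))
  have hS : S.topologicalClosure = ⊤ := by
    rw [← top_le_iff, ← span_fourierLp_closure_eq_top (T := 1) (p := 2) (by norm_num)]
    refine Submodule.topologicalClosure_mono ?_
    rw [Submodule.span_le]
    rintro _ ⟨n, rfl⟩
    exact ⟨_, Submodule.subset_span ⟨n, rfl⟩, toL2_fourierLp n⟩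
  have hf : f ∈ closure (S : Set L2) := by
    rw [← Submodule.topologicalClosure_coe, hS]
    trivial
  refine closure_minimal ?_ hcl hf
  rintro _ ⟨p, hp, rfl⟩
  exact h p hp

/-- If the matrix coefficients of a bounded operator with respect to `1, z, z², …` form the Toeplitz
matrix of a function `ψ ∈ L²`, then `ψ` is bounded. -/
lemma exists_toL2_eq_of_toeplitz (T : L2 →L[ℂ] L2) (ψ : L2)
    (h : ∀ i j : ℤ, 0 ≤ i → 0 ≤ j →
      inner ℂ (fourierLp 2 i : L2) (T (fourierLp 2 j)) = fourierCoeff ψ (i - j)) :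
    ∃ Ψ : Linf, toL2 Ψ = ψ := by
  -- The operators `z̄ⁿ T zⁿ` converge weakly to the multiplication by `ψ`.
  have hlim : ∀ q ∈ Submodule.span ℂ (Set.range fun n : ℤ => (fourierLp ∞ n : Linf)),
      ∀ p ∈ Submodule.span ℂ (Set.range fun n : ℤ => (fourierLp ∞ n : Linf)),
      Filter.Tendsto (fun n : ℕ => inner ℂ (M (fourierLp ∞ n) (toL2 q))
        (T (M (fourierLp ∞ n) (toL2 p)))) Filter.atTop (nhds (inner ℂ (toL2 q) (M p ψ))) := by
    intro q hq p hp
    induction hq, hp using Submodule.span_induction₂ with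
    | mem_mem x y hx hy =>
      obtain ⟨i, rfl⟩ := hx
      obtain ⟨j, rfl⟩ := hy
      refine tendsto_const_nhds.congr' ?_
      filter_upwards [Filter.eventually_ge_atTop (max i.natAbs j.natAbs)] with n hn
      simp only [toL2_fourierLp, M_fourierLp_fourierLp]
      rw [h _ _ (by omega) (by omega), inner_fourierLp, fourierCoeff_M_fourierLp]
      congr 1
      ring
    | zero_left y hy =>
      have : toL2 0 = 0 := by simpa using toL2_smul 0 0
      simp [this]
    | zero_right x hx =>
      have h1 : toL2 0 = 0 := by simpa using toL2_smul 0 0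
      have h2 : M 0 ψ = 0 := by simpa using M_smul_left 0 0 ψ
      simp [h1, h2]
    | add_left x y w hx hy hw h1 h2 =>
      simpa only [toL2_add, map_add, inner_add_left] using h1.add h2
    | add_right x y w hx hy hw h1 h2 =>
      simpa only [toL2_add, map_add, inner_add_right, M_add_left] using h1.add h2
    | smul_left c x y hx hy h1 =>
      simpa only [toL2_smul, map_smul, inner_smul_left] using h1.const_mul (conj c)
    | smul_right c x y hx hy h1 =>
      simpa only [toL2_smul, map_smul, inner_smul_right, M_smul_left] using h1.const_mul c
  have hbound : ∀ q ∈ Submodule.span ℂ (Set.range fun n : ℤ => (fourierLp ∞ n : Linf)),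
      ∀ p ∈ Submodule.span ℂ (Set.range fun n : ℤ => (fourierLp ∞ n : Linf)),
      ‖(inner ℂ (toL2 q) (M p ψ) : ℂ)‖ ≤ ‖T‖ * ‖toL2 q‖ * ‖toL2 p‖ := by
    intro q hq p hp
    refine le_of_tendsto (hlim q hq p hp).norm (Filter.Eventually.of_forall fun n => ?_)
    calc _ ≤ ‖M (fourierLp ∞ n) (toL2 q)‖ * ‖T (M (fourierLp ∞ n) (toL2 p))‖ :=
          norm_inner_le_norm _ _
      _ ≤ ‖M (fourierLp ∞ n) (toL2 q)‖ * (‖T‖ * ‖M (fourierLp ∞ n) (toL2 p)‖) := by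
          gcongr
          exact T.le_opNorm _
      _ = _ := by rw [norm_M_fourierLp, norm_M_fourierLp]; ring
  have hswap : ∀ q p : Linf,
      (inner ℂ (toL2 q) (M p ψ) : ℂ) = inner ℂ (M q (star ψ)) (toL2 p) := by
    intro q p
    rw [inner_M_right, ← inner_star_star, star_M, star_star, inner_M_left, ← toL2_star,
      M_toL2_comm]
  -- The trigonometric polynomials are dense: let first `p` and then `q` be arbitrary.
  have hbound' : ∀ q ∈ Submodule.span ℂ (Set.range fun n : ℤ => (fourierLp ∞ n : Linf)),
      ‖M q (star ψ)‖ ≤ ‖T‖ * ‖toL2 q‖ := fun q hq =>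
    norm_le_of_trigPoly _ (by positivity) fun p hp => by
      rw [← hswap]
      exact hbound q hq p hp
  have hswap' : ∀ q p : Linf,
      (inner ℂ (M p ψ) (toL2 q) : ℂ) = inner ℂ (toL2 p) (M q (star ψ)) := by
    intro q p
    rw [← inner_conj_symm, hswap, inner_conj_symm]
  have hfull : ∀ p : Linf, ‖M p ψ‖ ≤ ‖T‖ * ‖toL2 p‖ := fun p =>
    norm_le_of_trigPoly _ (by positivity) fun q hq => by
      rw [hswap']
      calc _ ≤ ‖toL2 p‖ * ‖M q (star ψ)‖ := norm_inner_le_norm _ _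
        _ ≤ ‖toL2 p‖ * (‖T‖ * ‖toL2 q‖) := by
          gcongr
          exact hbound' q hq
        _ = _ := by ring
  exact exists_toL2_eq_of_norm_M_le ψ _ hfull

lemma inner_fourierLp_M_fourierLp (Ψ : Linf) (i j : ℤ) :
    inner ℂ (fourierLp 2 i : L2) (M Ψ (fourierLp 2 j)) = fourierCoeff (toL2 Ψ) (i - j) := by
  rw [← toL2_fourierLp j, M_toL2_comm, inner_fourierLp, fourierCoeff_M_fourierLp]

lemma inner_eq_inner_of_mem_H2 {A B : L2 →L[ℂ] L2}
    (h : ∀ i j : ℤ, 0 ≤ i → 0 ≤ j → inner ℂ (fourierLp 2 i : L2) (A (fourierLp 2 j)) =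
      inner ℂ (fourierLp 2 i : L2) (B (fourierLp 2 j))) {f g : L2} (hf : f ∈ H2) (hg : g ∈ H2) :
    inner ℂ g (A f) = inner ℂ g (B f) := by
  have h1 : ∀ i : ℤ, 0 ≤ i → inner ℂ (fourierLp 2 i : L2) ((A - B) f) = 0 := fun i hi =>
    eq_zero_of_mem_H2 (innerSL ℂ (fourierLp 2 i : L2) ∘L (A - B))
      (fun j hj => by simp [h i j hi hj]) hf
  have h2 : inner ℂ ((A - B) f) g = 0 :=
    eq_zero_of_mem_H2 (innerSL ℂ ((A - B) f))
      (fun i hi => inner_eq_zero_symm.1 (h1 i hi)) hg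
  have h3 := inner_eq_zero_symm.1 h2
  rwa [sub_apply, inner_sub_right, sub_eq_zero] at h3

/-- **Brown–Halmos**: a bounded operator whose compression to `H²` has a Toeplitz matrix compresses
to a Toeplitz operator with bounded symbol. -/
lemma exists_symbol_of_toeplitz (T : L2 →L[ℂ] L2)
    (h : ∀ i j : ℤ, 0 ≤ i → 0 ≤ j →
      inner ℂ (fourierLp 2 (i + 1) : L2) (T (fourierLp 2 (j + 1))) =
        inner ℂ (fourierLp 2 i : L2) (T (fourierLp 2 j))) :
    ∃ Ψ : Linf, ∀ f ∈ H2, ∀ g ∈ H2, inner ℂ g (T f) = inner ℂ g (M Ψ f) := by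
  have hshift : ∀ (n : ℕ) (i j : ℤ), 0 ≤ i → 0 ≤ j →
      inner ℂ (fourierLp 2 (i + n) : L2) (T (fourierLp 2 (j + n))) =
        inner ℂ (fourierLp 2 i : L2) (T (fourierLp 2 j)) := by
    intro n i j hi hj
    induction n with
    | zero => simp
    | succ n ih =>
      rw [← ih, ← h (i + n) (j + n) (by omega) (by omega), Nat.cast_succ, add_assoc, add_assoc]
  -- The first column of the matrix gives the coefficients of index `≥ 0` of the symbol, the first
  -- row gives the others.
  set a : L2 := T (fourierLp 2 0) with ha
  set b : L2 := star (ContinuousLinearMap.adjoint T (fourierLp 2 0)) with hb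
  set ψ : L2 := H2.starProjection a + (b - H2.starProjection b) with hψ
  have hψc : ∀ i j : ℤ, 0 ≤ i → 0 ≤ j →
      inner ℂ (fourierLp 2 i : L2) (T (fourierLp 2 j)) = fourierCoeff ψ (i - j) := by
    intro i j hi hj
    rw [hψ, fourierCoeff_add, fourierCoeff_sub]
    rcases le_or_gt j i with hij | hij
    · rw [fourierCoeff_starProjection_H2_of_nonneg _ (by omega),
        fourierCoeff_starProjection_H2_of_nonneg _ (by omega), sub_self, add_zero,
        ← inner_fourierLp, ha,
        ← hshift j.toNat (i - j) 0 (by omega) le_rfl]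
      congr 3 <;> omega
    · rw [fourierCoeff_starProjection_H2_of_neg _ (by omega),
        fourierCoeff_starProjection_H2_of_neg _ (by omega), sub_zero, zero_add, hb,
        fourierCoeff_star,
        ← inner_fourierLp, ContinuousLinearMap.adjoint_inner_right, inner_conj_symm,
        ← hshift i.toNat 0 (-(i - j)) le_rfl (by omega)]
      congr 3 <;> omega
  obtain ⟨Ψ, hΨ⟩ := exists_toL2_eq_of_toeplitz T ψ hψc
  refine ⟨Ψ, fun f hf g hg => inner_eq_inner_of_mem_H2 (fun i j hi hj => ?_) hf hg⟩
  rw [hψc i j hi hj, inner_fourierLp_M_fourierLp, hΨ]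

/-! ### The conditions as identities between sesquilinear forms -/

/-- The operator `D : K_θ^⊥ → K_α^⊥`, extended by zero on `K_θ` to an operator on `L²`. -/
noncomputable def extend {θ α : InnerFunction} (D : Kperp θ →L[ℂ] Kperp α) : L2 →L[ℂ] L2 :=
  (Kperp α).subtypeL ∘L D ∘L (Kperp θ).orthogonalProjectionOnto

variable {θ α : InnerFunction} (D : Kperp θ →L[ℂ] Kperp α)

lemma extend_apply_coe (u : Kperp θ) : extend D u = D u := by
  simp [extend]

lemma extend_apply {u : L2} (hu : u ∈ Kperp θ) : extend D u = D ⟨u, hu⟩ :=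
  extend_apply_coe D ⟨u, hu⟩

lemma inner_compress {V W S T : Submodule ℂ L2} (A : V →L[ℂ] W) [T.HasOrthogonalProjection]
    (hS : S ≤ V) (u : S) (v : T) :
    inner ℂ v (compress A S T hS u) = inner ℂ (v : L2) (A ⟨u, hS u.2⟩ : L2) :=
  Submodule.inner_orthogonalProjectionOnto_eq_of_mem_left v _

lemma inner_compressM {S T : Submodule ℂ L2} (φ : Linf) [T.HasOrthogonalProjection] (u : S) (v : T) :
    inner ℂ v (compressM φ S T u) = inner ℂ (v : L2) (M φ u) :=
  Submodule.inner_orthogonalProjectionOnto_eq_of_mem_left v _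

lemma inner_block11 (u : thetaH2 θ) (v : thetaH2 α) :
    inner ℂ v (block11 D u) = inner ℂ (v : L2) (extend D u) := by
  rw [extend_apply D (thetaH2_le_Kperp θ u.2)]
  exact inner_compress _ _ _ _

lemma inner_block12 (u : H2minus) (v : thetaH2 α) :
    inner ℂ v (block12 D u) = inner ℂ (v : L2) (extend D u) := by
  rw [extend_apply D (H2minus_le_Kperp θ u.2)]
  exact inner_compress _ _ _ _

lemma inner_block21 (u : thetaH2 θ) (v : H2minus) :
    inner ℂ v (block21 D u) = inner ℂ (v : L2) (extend D u) := by
  rw [extend_apply D (thetaH2_le_Kperp θ u.2)]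
  exact inner_compress _ _ _ _

lemma inner_block22 (u : H2minus) (v : H2minus) :
    inner ℂ v (block22 D u) = inner ℂ (v : L2) (extend D u) := by
  rw [extend_apply D (H2minus_le_Kperp θ u.2)]
  exact inner_compress _ _ _ _

lemma coe_hatT_z (u : thetaH2 θ) : (hatT θ z u : L2) = M z u :=
  Submodule.starProjection_eq_self_iff.2 (M_z_mem_thetaH2 u.2)

lemma inner_adjoint_coe (v : Kperp α) {u : L2} (hu : u ∈ Kperp θ) :
    inner ℂ u (adjoint D v : L2) = inner ℂ (extend D u) (v : L2) := by
  rw [extend_apply D hu]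
  exact ContinuousLinearMap.adjoint_inner_right D ⟨u, hu⟩ v

lemma Pminus_eq_iff {f g : L2} :
    Pminus f = Pminus g ↔ ∀ h ∈ H2minus, inner ℂ h f = inner ℂ h g := by
  rw [← sub_eq_zero, ← map_sub, Submodule.starProjection_apply_eq_zero_iff,
    Submodule.mem_orthogonal]
  simp only [inner_sub_right, sub_eq_zero]

lemma block11_eq_iff : block11 D = hatT α (star z) ∘L block11 D ∘L hatT θ z ↔
    ∀ u ∈ thetaH2 θ, ∀ v ∈ thetaH2 α,
      inner ℂ v (extend D u) = inner ℂ (M z v) (extend D (M z u)) := by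
  have key : ∀ (u : thetaH2 θ) (v : thetaH2 α),
      inner ℂ v ((hatT α (star z) ∘L block11 D ∘L hatT θ z) u) =
        inner ℂ (M z v) (extend D (M z u)) := by
    intro u v
    rw [← coe_hatT_z u, ← coe_hatT_z v, ← inner_block11]
    simp only [ContinuousLinearMap.comp_apply]
    rw [inner_compressM, ← inner_M_left, ← coe_hatT_z v, Submodule.coe_inner]
  constructor
  · intro h u hu v hv
    rw [← key ⟨u, hu⟩ ⟨v, hv⟩, ← h, inner_block11]
  · intro h
    ext1 u
    refine ext_inner_left ℂ fun v => ?_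
    rw [key, inner_block11, h _ u.2 _ v.2]

lemma M_C_mem_left {f : L2} (hf : f ∈ H2minus) : M θ (C α f) ∈ thetaH2 θ :=
  ⟨_, M_mem_H2 α (star_mul_star_mem_H2 hf), rfl⟩

/-- The conjugation `C_α` is antiunitary. -/
lemma inner_C_comm (f g : L2) : inner ℂ f (C α g) = inner ℂ g (C α f) := by
  rw [C, C, inner_M_right, inner_M_right, star_star, ← inner_star_star, star_M, star_M,
    star_star, star_star, M_comm]

/-- Since `C_α` is antiunitary, `⟨g, C_α h⟩ = ⟨h, C_α g⟩`, which moves `g` inside the adjoint of the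
`αH²`-block. -/
lemma block22_eq_iff : (∀ f : H2minus, (block22 D f : L2) =
      Pminus (C α (M (star (θ : Linf)) (adjoint (block11 D) (MC θ α f) : L2)))) ↔
    ∀ f ∈ H2minus, ∀ g ∈ H2minus,
      inner ℂ g (extend D f) = inner ℂ (M θ (C α f)) (extend D (M θ (C α g))) := by
  have key : ∀ f g : H2minus,
      inner ℂ (g : L2) (Pminus (C α (M (star (θ : Linf)) (adjoint (block11 D) (MC θ α f) : L2)))) =
        inner ℂ (M θ (C α f)) (extend D (M θ (C α g))) := by
    intro f g
    have hu : M θ (C α g) ∈ thetaH2 θ := M_C_mem_left g.2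
    rw [← Submodule.inner_starProjection_left_eq_right,
      Submodule.starProjection_eq_self_iff.2 g.2, inner_C_comm, inner_M_left, star_star]
    refine (ContinuousLinearMap.adjoint_inner_left (block11 D) ⟨_, hu⟩ (MC θ α f)).trans ?_
    rw [inner_block11]
    rfl
  constructor
  · intro h f hf g hg
    rw [← key ⟨f, hf⟩ ⟨g, hg⟩, ← h, ← inner_block22 D ⟨f, hf⟩ ⟨g, hg⟩, Submodule.coe_inner]
  · intro h f
    have h1 : (block22 D f : L2) - Pminus (C α (M (star (θ : Linf))
        (adjoint (block11 D) (MC θ α f) : L2))) ∈ H2minus :=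
      Submodule.sub_mem _ (block22 D f).2 (Submodule.starProjection_apply_mem _ _)
    rw [← sub_eq_zero, ← inner_self_eq_zero (𝕜 := ℂ), inner_sub_right, sub_eq_zero]
    rw [key f ⟨_, h1⟩, ← h _ f.2 _ h1, ← inner_block22 D f ⟨_, h1⟩, Submodule.coe_inner]

lemma block21_eq_iff : block21 D ∘L hatT θ z = checkT z ∘L block21 D ↔
    ∀ u ∈ thetaH2 θ, ∀ g ∈ H2minus,
      inner ℂ g (extend D (M z u)) = inner ℂ (M (star z) g) (extend D u) := by
  have h1 : ∀ (u : thetaH2 θ) (g : H2minus), inner ℂ g ((block21 D ∘L hatT θ z) u) =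
      inner ℂ (g : L2) (extend D (M z u)) := by
    intro u g
    rw [ContinuousLinearMap.comp_apply, inner_block21, coe_hatT_z]
  have h2 : ∀ (u : thetaH2 θ) (g : H2minus), inner ℂ g ((checkT z ∘L block21 D) u) =
      inner ℂ (M (star z) g) (extend D u) := by
    intro u g
    rw [ContinuousLinearMap.comp_apply, inner_compressM, inner_M_right]
    exact inner_block21 D u ⟨_, M_star_z_mem_H2minus g.2⟩
  constructor
  · intro h u hu g hg
    rw [← h1 ⟨u, hu⟩ ⟨g, hg⟩, h, h2]
  · intro h
    ext1 u
    refine ext_inner_left ℂ fun g => ?_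
    rw [h1, h2, h _ u.2 _ g.2]

lemma block12_eq_iff : adjoint (block12 D) ∘L hatT α z = checkT z ∘L adjoint (block12 D) ↔
    ∀ g ∈ H2minus, ∀ v ∈ thetaH2 α,
      inner ℂ (M z v) (extend D g) = inner ℂ v (extend D (M (star z) g)) := by
  have h1 : ∀ (v : thetaH2 α) (g : H2minus),
      inner ℂ ((adjoint (block12 D) ∘L hatT α z) v) g = inner ℂ (M z v) (extend D g) := by
    intro v g
    rw [ContinuousLinearMap.comp_apply, ContinuousLinearMap.adjoint_inner_left, inner_block12,
      coe_hatT_z]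
  have h2 : ∀ (v : thetaH2 α) (g : H2minus),
      inner ℂ ((checkT z ∘L adjoint (block12 D)) v) g =
        inner ℂ (v : L2) (extend D (M (star z) g)) := by
    intro v g
    rw [ContinuousLinearMap.comp_apply, ← inner_conj_symm, inner_compressM, inner_conj_symm,
      inner_M_left]
    refine (ContinuousLinearMap.adjoint_inner_left (block12 D)
      ⟨_, M_star_z_mem_H2minus g.2⟩ v).trans ?_
    rw [inner_block12]
  constructor
  · intro h g hg v hv
    rw [← h1 ⟨v, hv⟩ ⟨g, hg⟩, h, h2]
  · intro h
    ext1 v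
    refine ext_inner_right ℂ fun g => ?_
    rw [h1, h2, h _ g.2 _ v.2]

lemma M_M_star_mem_thetaH2_left {g : L2} (hg : g ∈ H2minus) : M θ (M α (star g)) ∈ thetaH2 θ :=
  ⟨_, M_mem_H2 α (star_mem_H2 hg), rfl⟩

lemma M_M_star_mem_thetaH2_right {g : L2} (hg : g ∈ H2minus) : M θ (M α (star g)) ∈ thetaH2 α :=
  ⟨_, M_mem_H2 θ (star_mem_H2 hg), M_comm _ _ _⟩

lemma inner_M_M_star_comm (f g : L2) :
    inner ℂ g (M θ (M α (star f))) = inner ℂ f (M θ (M α (star g))) := by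
  rw [← inner_star_star, star_M, star_M, star_star, inner_M_left, inner_M_left, star_star,
    star_star, M_comm]

lemma Pminus_D_self_eq_iff :
    Pminus (D (self θ)) = Pminus (M θ (M α (star (adjoint D (self α) : L2)))) ↔
    ∀ g ∈ H2minus, inner ℂ g (extend D (toL2 θ)) =
      inner ℂ (toL2 α) (extend D (M θ (M α (star g)))) := by
  rw [Pminus_eq_iff]
  refine forall₂_congr fun g hg => ?_
  rw [inner_M_M_star_comm, ← inner_conj_symm _ (M θ (M α (star g))),
    inner_adjoint_coe D _ (thetaH2_le_Kperp θ (M_M_star_mem_thetaH2_left hg)), inner_conj_symm,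
    ← extend_apply_coe]
  rfl

lemma Pminus_adjoint_self_eq_iff :
    Pminus (adjoint D (self α)) = Pminus (M θ (M α (star (D (self θ) : L2)))) ↔
    ∀ g ∈ H2minus, inner ℂ (toL2 α) (extend D g) =
      inner ℂ (M θ (M α (star g))) (extend D (toL2 θ)) := by
  rw [Pminus_eq_iff]
  refine forall₂_congr fun g hg => ?_
  rw [inner_M_M_star_comm, inner_adjoint_coe D _ (H2minus_le_Kperp θ hg), ← extend_apply_coe]
  rw [← inner_conj_symm, ← inner_conj_symm (extend D _), (starRingEnd ℂ).injective.eq_iff]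
  rfl

/-! ### Operators with bounded symbol -/

lemma inner_M_z_M_M_z (φ : Linf) (u v : L2) :
    inner ℂ (M z v) (M φ (M z u)) = inner ℂ v (M φ u) := by
  rw [inner_M_left, M_comm (star z), M_star_z_M_z]

/-- Multiplication operators satisfy the identity that links the blocks `H²₋ → H²₋` and `θH² → αH²`. -/
lemma inner_M_C_M_M_C (φ : Linf) (f g : L2) :
    inner ℂ (M θ (C α f)) (M φ (M θ (C α g))) = inner ℂ g (M φ f) := by
  rw [M_comm φ, inner_M_M, C, C, M_comm φ, inner_M_M, inner_M_left, M_comm φ, star_star,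
    M_z_M_star_z, ← inner_star_star, star_star, star_M, star_star, inner_M_left, star_star]

lemma inner_toL2_M (θ : InnerFunction) (f : L2) :
    inner ℂ (toL2 θ) (M θ f) = inner ℂ (fourierLp 2 0 : L2) f := by
  rw [← M_fourierLp_zero, inner_M_M]

lemma inner_self_M_M_M_star (φ : Linf) (g : L2) :
    inner ℂ (toL2 α) (M φ (M θ (M α (star g)))) = inner ℂ g (M φ (toL2 θ)) := by
  rw [M_comm θ, M_comm φ, inner_toL2_M, ← inner_star_star, star_M, star_M, star_star,
    star_fourierLp_two, neg_zero, inner_M_left, inner_M_left, star_star, star_star, M_comm,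
    M_fourierLp_zero]

lemma inner_M_M_star_M_self (φ : Linf) (g : L2) :
    inner ℂ (M θ (M α (star g))) (M φ (toL2 θ)) = inner ℂ (toL2 α) (M φ g) := by
  rw [← M_fourierLp_zero θ, M_comm φ, inner_M_M, inner_M_left, ← inner_star_star, star_M, star_M,
    star_star, star_fourierLp_two, neg_zero, star_star, M_comm α, inner_M_left (star φ),
    star_star, M_fourierLp_zero]

lemma extend_eq_starProjection {φ : Linf} (hD : D = dualTT θ α φ) {u : L2} (hu : u ∈ Kperp θ) :
    extend D u = (Kperp α).starProjection (M φ u) := by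
  rw [extend_apply D hu, hD]
  rfl

lemma inner_extend_dualTT {φ : Linf} (hD : D = dualTT θ α φ) {u v : L2} (hu : u ∈ Kperp θ)
    (hv : v ∈ Kperp α) : inner ℂ v (extend D u) = inner ℂ v (M φ u) := by
  rw [extend_eq_starProjection D hD hu, ← Submodule.inner_starProjection_left_eq_right,
    Submodule.starProjection_eq_self_iff.2 hv]

/-- An operator has bounded symbol `φ` as soon as its sesquilinear form agrees with that of `M_φ`
on each of the four blocks of the decompositions `K_θ^⊥ = θH² ⊕ H²₋`, `K_α^⊥ = αH² ⊕ H²₋`. -/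
lemma eq_dualTT_of_blocks {φ : Linf}
    (h11 : ∀ u ∈ thetaH2 θ, ∀ v ∈ thetaH2 α, inner ℂ v (extend D u) = inner ℂ v (M φ u))
    (h12 : ∀ u ∈ H2minus, ∀ v ∈ thetaH2 α, inner ℂ v (extend D u) = inner ℂ v (M φ u))
    (h21 : ∀ u ∈ thetaH2 θ, ∀ v ∈ H2minus, inner ℂ v (extend D u) = inner ℂ v (M φ u))
    (h22 : ∀ u ∈ H2minus, ∀ v ∈ H2minus, inner ℂ v (extend D u) = inner ℂ v (M φ u)) :
    D = dualTT θ α φ := by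
  ext1 u
  refine ext_inner_left ℂ fun v => ?_
  rw [inner_compressM, Submodule.coe_inner, ← extend_apply_coe]
  obtain ⟨u₁, hu₁, u₂, hu₂, hu⟩ := exists_of_mem_Kperp u.2
  obtain ⟨v₁, hv₁, v₂, hv₂, hv⟩ := exists_of_mem_Kperp v.2
  rw [hu, hv]
  simp only [map_add, inner_add_left, inner_add_right]
  rw [h11 _ hu₁ _ hv₁, h12 _ hu₂ _ hv₁, h21 _ hu₁ _ hv₂, h22 _ hu₂ _ hv₂]

lemma isADTTO_dualTT (φ : Linf) : IsADTTO (dualTT θ α φ) := by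
  refine ⟨toL2 φ, fun f hf => ?_⟩
  rw [lpSMul_eq_M, M_toL2_comm]
  rfl

/-- The operator `f ↦ ᾱ D (θ f)`, whose compression to `H²` corresponds to the block
`P_{αH²} D|_{θH²}` through the unitaries `M_θ : H² → θH²` and `M_α : H² → αH²`. -/
noncomputable def transport : L2 →L[ℂ] L2 := M (star (α : Linf)) ∘L extend D ∘L M θ

lemma inner_transport (f g : L2) :
    inner ℂ g (transport D f) = inner ℂ (M α g) (extend D (M θ f)) := by
  rw [inner_M_left]
  rfl

/-- The symbol of an asymmetric dual truncated Toeplitz operator is bounded. -/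
lemma exists_eq_dualTT_of_isADTTO (hD : IsADTTO D) : ∃ φ : Linf, D = dualTT θ α φ := by
  obtain ⟨φ, hφ⟩ := hD
  have hφ' : ∀ f : Linf, toL2 f ∈ Kperp θ → ∀ v ∈ Kperp α,
      inner ℂ v (extend D (toL2 f)) = inner ℂ v (M f φ) := by
    intro f hf v hv
    rw [extend_apply D hf, hφ f hf, lpSMul_eq_M]
    exact Submodule.inner_orthogonalProjectionOnto_eq_of_mem_left (⟨v, hv⟩ : Kperp α) _
  have hmem : ∀ (θ : InnerFunction) (n : ℤ), 0 ≤ n → M θ (fourierLp 2 n) ∈ thetaH2 θ :=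
    fun θ n hn => ⟨_, fourierLp_mem_H2 hn, rfl⟩
  have htop : ∀ n : ℤ, M θ (fourierLp 2 n) = toL2 ((θ : Linf) • (fourierLp ∞ n : Linf) : Linf) :=
    fun n => by rw [toL2_M, toL2_fourierLp]
  obtain ⟨Ψ, hΨ⟩ := exists_toL2_eq_of_toeplitz (transport D) (M (star (α : Linf)) (M θ φ)) (by
    intro i j hi hj
    have h1 := htop j ▸ thetaH2_le_Kperp θ (hmem θ j hj)
    rw [inner_transport, htop, hφ' _ h1 _ (thetaH2_le_Kperp α (hmem α i hi)), inner_M_left,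
      M_lpSMul, M_comm θ, M_comm (star (α : Linf)), inner_fourierLp, fourierCoeff_M_fourierLp])
  -- The bounded function is `Ψ = ᾱ θ φ`; undo the factor `ᾱ θ`.
  set Φ : Linf := ((α : Linf) • ((star (θ : Linf)) • Ψ : Linf) : Linf) with hΦ
  have hΦφ : toL2 Φ = φ := by
    rw [hΦ, toL2_M, toL2_M, hΨ, M_comm (star (θ : Linf)), M_M_star, M_star_M]
  have hbdd : ∀ f : Linf, toL2 f ∈ Kperp θ → ∀ v ∈ Kperp α,
      inner ℂ v ((extend D - M Φ) (toL2 f)) = 0 := by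
    intro f hf v hv
    rw [sub_apply, inner_sub_right, hφ' f hf v hv, ← hΦφ, M_toL2_comm, sub_self]
  -- Bounded functions are dense in `θH²` and in `H²₋`.
  have h1 : ∀ u ∈ thetaH2 θ, ∀ v ∈ Kperp α, inner ℂ v (extend D u) = inner ℂ v (M Φ u) := by
    rintro _ ⟨u, hu, rfl⟩ v hv
    have := eq_zero_of_mem_H2 (innerSL ℂ v ∘L (extend D - M Φ) ∘L M θ) (fun n hn => by
      have h2 := htop n ▸ thetaH2_le_Kperp θ (hmem θ n hn)
      have h3 := hbdd _ h2 v hv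
      rwa [← htop n] at h3) hu
    rw [← sub_eq_zero, ← inner_sub_right]
    exact this
  have h2 : ∀ u ∈ H2minus, ∀ v ∈ Kperp α, inner ℂ v (extend D u) = inner ℂ v (M Φ u) := by
    intro u hu v hv
    have := eq_zero_of_mem_H2minus (innerSL ℂ v ∘L (extend D - M Φ)) (fun n hn => by
      have h2 := toL2_fourierLp n ▸ H2minus_le_Kperp θ (fourierLp_mem_H2minus hn)
      have h3 := hbdd _ h2 v hv
      rwa [toL2_fourierLp n] at h3) hu
    rw [← sub_eq_zero, ← inner_sub_right]
    exact this
  exact ⟨Φ, eq_dualTT_of_blocks D (fun u hu v hv => h1 u hu v (thetaH2_le_Kperp α hv))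
    (fun u hu v hv => h2 u hu v (thetaH2_le_Kperp α hv))
    (fun u hu v hv => h1 u hu v (H2minus_le_Kperp α hv))
    (fun u hu v hv => h2 u hu v (H2minus_le_Kperp α hv))⟩

/-- The identities `h1`–`h4'` recover a bounded symbol: `h1` provides it, the others show that it
represents the remaining three blocks. -/
lemma exists_eq_dualTT_of_inner_eq
    (h1 : ∀ u ∈ thetaH2 θ, ∀ v ∈ thetaH2 α,
      inner ℂ v (extend D u) = inner ℂ (M z v) (extend D (M z u)))
    (h2 : ∀ f ∈ H2minus, ∀ g ∈ H2minus,
      inner ℂ g (extend D f) = inner ℂ (M θ (C α f)) (extend D (M θ (C α g))))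
    (h3 : ∀ u ∈ thetaH2 θ, ∀ g ∈ H2minus,
      inner ℂ g (extend D (M z u)) = inner ℂ (M (star z) g) (extend D u))
    (h3' : ∀ g ∈ H2minus, ∀ v ∈ thetaH2 α,
      inner ℂ (M z v) (extend D g) = inner ℂ v (extend D (M (star z) g)))
    (h4 : ∀ g ∈ H2minus, inner ℂ g (extend D (toL2 θ)) =
      inner ℂ (toL2 α) (extend D (M θ (M α (star g)))))
    (h4' : ∀ g ∈ H2minus, inner ℂ (toL2 α) (extend D g) =
      inner ℂ (M θ (M α (star g))) (extend D (toL2 θ))) :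
    ∃ φ : Linf, D = dualTT θ α φ := by
  have hmem : ∀ (θ : InnerFunction) (n : ℤ), 0 ≤ n → M θ (fourierLp 2 n) ∈ thetaH2 θ :=
    fun θ n hn => ⟨_, fourierLp_mem_H2 hn, rfl⟩
  have hz : ∀ (θ : InnerFunction) (n : ℤ), M θ (fourierLp 2 (n + 1)) = M z (M θ (fourierLp 2 n)) :=
    fun θ n => by rw [M_comm, M_z_fourierLp]
  obtain ⟨Ψ, hΨ⟩ := exists_symbol_of_toeplitz (transport D) (by
    intro i j hi hj
    rw [inner_transport, inner_transport, hz, hz, ← h1 _ (hmem θ j hj) _ (hmem α i hi)])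
  -- The symbol of the transported operator is `ᾱ θ φ`.
  set φ : Linf := ((α : Linf) • ((star (θ : Linf)) • Ψ : Linf) : Linf) with hφ
  have h11 : ∀ u ∈ thetaH2 θ, ∀ v ∈ thetaH2 α,
      inner ℂ v (extend D u) = inner ℂ v (M φ u) := by
    rintro _ ⟨f, hf, rfl⟩ _ ⟨g, hg, rfl⟩
    refine (inner_transport D f g).symm.trans ((hΨ f hf g hg).trans ?_)
    change _ = inner ℂ (M α g) (M φ (M θ f))
    rw [hφ, M_lpSMul, M_lpSMul, inner_M_M, M_comm Ψ, M_star_M]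
  have h22 : ∀ f ∈ H2minus, ∀ g ∈ H2minus, inner ℂ g (extend D f) = inner ℂ g (M φ f) := by
    intro f hf g hg
    rw [h2 f hf g hg, h11 _ (M_C_mem_left hg) _ (M_C_mem θ α hf)]
    exact inner_M_C_M_M_C φ f g
  have h21n : ∀ n : ℕ, ∀ g ∈ H2minus, inner ℂ g (extend D (M θ (fourierLp 2 n))) =
      inner ℂ g (M φ (M θ (fourierLp 2 n))) := by
    intro n
    induction n with
    | zero =>
      intro g hg
      rw [Nat.cast_zero, M_fourierLp_zero, h4 g hg,
        h11 _ (M_M_star_mem_thetaH2_left hg) _ (toL2_mem_thetaH2 α), inner_self_M_M_M_star]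
    | succ n ih =>
      intro g hg
      rw [Nat.cast_succ, hz, h3 _ (hmem θ n (by omega)) g hg, ih _ (M_star_z_mem_H2minus hg),
        M_comm φ z, inner_M_right z]
  have h12n : ∀ n : ℕ, ∀ g ∈ H2minus, inner ℂ (M α (fourierLp 2 n)) (extend D g) =
      inner ℂ (M α (fourierLp 2 n)) (M φ g) := by
    intro n
    induction n with
    | zero =>
      intro g hg
      rw [Nat.cast_zero, M_fourierLp_zero, h4' g hg,
        h11 _ (toL2_mem_thetaH2 θ) _ (M_M_star_mem_thetaH2_right hg), inner_M_M_star_M_self]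
    | succ n ih =>
      intro g hg
      rw [Nat.cast_succ, hz, h3' g hg _ (hmem α n (by omega)), ih _ (M_star_z_mem_H2minus hg),
        M_comm φ, inner_M_left z]
  refine ⟨φ, eq_dualTT_of_blocks D h11 ?_ ?_ h22⟩
  · rintro g hg _ ⟨v, hv, rfl⟩
    have := eq_zero_of_mem_H2 (innerSL ℂ ((extend D - M φ) g) ∘L M α) (fun n hn => by
      lift n to ℕ using hn
      refine (inner_eq_zero_symm (𝕜 := ℂ) (x := M α (fourierLp 2 n))).1 ?_
      rw [sub_apply, inner_sub_right, h12n n g hg, sub_self]) hv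
    rw [← sub_eq_zero, ← inner_sub_right]
    exact inner_eq_zero_symm.1 this
  · rintro _ ⟨u, hu, rfl⟩ g hg
    have := eq_zero_of_mem_H2 (innerSL ℂ g ∘L (extend D - M φ) ∘L M θ) (fun n hn => by
      lift n to ℕ using hn
      change inner ℂ g ((extend D - M φ) (M θ (fourierLp 2 n))) = 0
      rw [sub_apply, inner_sub_right, h21n n g hg, sub_self]) hu
    rw [← sub_eq_zero, ← inner_sub_right]
    exact this

lemma Ptheta_eq (θ : InnerFunction) (f : L2) :
    Ptheta θ f = M θ (H2.starProjection (M (star (θ : Linf)) f)) := by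
  refine Submodule.eq_starProjection_of_mem_of_inner_eq_zero
    ⟨_, Submodule.starProjection_apply_mem _ _, rfl⟩ ?_
  rintro _ ⟨h, hh, rfl⟩
  change inner ℂ _ (M θ h) = 0
  rw [inner_M_right, map_sub, M_star_M]
  exact Submodule.starProjection_inner_eq_zero _ _ hh

lemma Ptheta_starProjection_Kperp (θ : InnerFunction) (f : L2) :
    Ptheta θ ((Kperp θ).starProjection f) = Ptheta θ f := by
  rw [← sub_eq_zero, ← map_sub, Submodule.starProjection_apply_eq_zero_iff,
    ← neg_sub, Submodule.neg_mem_iff]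
  exact Submodule.orthogonal_le (thetaH2_le_Kperp θ) (Submodule.sub_starProjection_mem_orthogonal f)

/-- The adjoint has the conjugate symbol, and `θ` and `α` are exchanged. -/
lemma adjoint_dualTT (φ : Linf) : adjoint (dualTT θ α φ) = dualTT α θ (star φ) := by
  symm
  rw [ContinuousLinearMap.eq_adjoint_iff]
  intro v u
  rw [inner_compressM, ← inner_conj_symm, inner_compressM, inner_conj_symm, inner_M_left, star_star]

/-- A function is recovered from the analytic parts of itself and of its conjugate. -/
lemma starProjection_add_star_sub (χ : L2) :
    H2.starProjection χ + star (H2.starProjection (star χ)) -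
      fourierCoeff χ 0 • (fourierLp 2 0 : L2) = χ := by
  refine ext_fourierCoeff fun n => ?_
  have h0 : fourierCoeff (fourierCoeff χ 0 • (fourierLp 2 0 : L2) : L2) n =
      if n = 0 then fourierCoeff χ 0 else 0 := by
    rw [← inner_fourierLp, inner_smul_right, orthonormal_iff_ite.1 orthonormal_fourier]
    simp
  rw [fourierCoeff_sub, fourierCoeff_add, fourierCoeff_star, h0]
  rcases lt_trichotomy n 0 with hn | rfl | hn
  · rw [fourierCoeff_starProjection_H2_of_neg _ hn,
      fourierCoeff_starProjection_H2_of_nonneg _ (by omega), fourierCoeff_star, if_neg hn.ne]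
    simp
  · rw [fourierCoeff_starProjection_H2_of_nonneg _ le_rfl, neg_zero,
      fourierCoeff_starProjection_H2_of_nonneg _ le_rfl, fourierCoeff_star]
    simp
  · rw [fourierCoeff_starProjection_H2_of_nonneg _ hn.le,
      fourierCoeff_starProjection_H2_of_neg _ (by omega), if_neg hn.ne']
    simp

/-- The symbol is recovered from `D θ` and `D* α`. -/
lemma toL2_eq_of_eq_dualTT {φ : Linf} (hD : D = dualTT θ α φ) :
    toL2 φ =
      M (star (θ : Linf)) (Ptheta α (D (self θ))) +
        M α (star (Ptheta θ (adjoint D (self α)))) -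
        M α (star (inner ℂ (toL2 θ) (adjoint D (self α) : L2) • toL2 θ)) := by
  obtain ⟨χ, hχ⟩ : ∃ χ : L2, χ = M (star (α : Linf)) (M θ (toL2 φ)) := ⟨_, rfl⟩
  have hχ' : star χ = M (star (θ : Linf)) (M α (toL2 (star φ))) := by
    rw [hχ, star_M, star_M, star_star, M_comm, toL2_star]
  have h1 : Ptheta α (D (self θ)) = M α (H2.starProjection χ) := by
    have : (D (self θ) : L2) = (Kperp α).starProjection (M φ (toL2 θ)) := by rw [hD]; rfl
    rw [this, Ptheta_starProjection_Kperp, Ptheta_eq, M_toL2_comm, hχ]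
  have hadj : (adjoint D (self α) : L2) = (Kperp θ).starProjection (M (star φ) (toL2 α)) := by
    rw [hD, adjoint_dualTT]; rfl
  have h2 : Ptheta θ (adjoint D (self α)) = M θ (H2.starProjection (star χ)) := by
    rw [hadj, Ptheta_starProjection_Kperp, Ptheta_eq, M_toL2_comm, hχ']
  have h3 : inner ℂ (toL2 θ) (adjoint D (self α) : L2) = conj (fourierCoeff χ 0) := by
    rw [hadj, ← Submodule.inner_starProjection_left_eq_right,
      Submodule.starProjection_eq_self_iff.2 (thetaH2_le_Kperp θ (toL2_mem_thetaH2 θ)),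
      M_toL2_comm, ← M_fourierLp_zero θ, inner_M_left, ← hχ', inner_fourierLp, fourierCoeff_star,
      neg_zero]
  rw [h1, h2, h3, star_const_smul, Complex.conj_conj, ← M_fourierLp_zero θ, star_M, star_M,
    star_fourierLp_two, neg_zero, map_smul, M_comm (star (θ : Linf)), ← map_smul, ← map_smul,
    ← map_add, ← map_sub, ← map_add, ← map_sub, starProjection_add_star_sub, hχ,
    M_comm (star (θ : Linf)), M_M_star, M_star_M]

end DualTTO

open DualTTO ContinuousLinearMap in
theorem theorem3p4 (θ α : InnerFunction) (D : Kperp θ →L[ℂ] Kperp α) :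
    (IsADTTO D ↔
      block11 D = hatT α (star z) ∘L block11 D ∘L hatT θ z ∧
      (∀ f : H2minus,
        (block22 D f : L2) =
          Pminus (C α (M (star (θ : Linf)) (adjoint (block11 D) (MC θ α f) : L2)))) ∧
      (block21 D ∘L hatT θ z = checkT z ∘L block21 D ∧
        adjoint (block12 D) ∘L hatT α z = checkT z ∘L adjoint (block12 D)) ∧
      (Pminus (D (self θ)) =
          Pminus (M θ (M α (star (adjoint D (self α) : L2)))) ∧
        Pminus (adjoint D (self α)) =
          Pminus (M θ (M α (star (D (self θ) : L2)))))) ∧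
    (IsADTTO D →
      ∃ φ : Linf,
        toL2 φ =
          M (star (θ : Linf)) (Ptheta α (D (self θ))) +
            M α (star (Ptheta θ (adjoint D (self α)))) -
            M α (star (inner ℂ (toL2 θ) (adjoint D (self α) : L2) • toL2 θ)) ∧
        D = dualTT θ α φ) := by
  rw [block11_eq_iff, block22_eq_iff, block21_eq_iff, block12_eq_iff, Pminus_D_self_eq_iff,
    Pminus_adjoint_self_eq_iff]
  refine ⟨⟨fun hD => ?_, fun ⟨h1, h2, ⟨h3, h3'⟩, h4, h4'⟩ => ?_⟩, fun hD => ?_⟩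
  · obtain ⟨φ, hφ⟩ := exists_eq_dualTT_of_isADTTO D hD
    have key : ∀ u ∈ Kperp θ, ∀ v ∈ Kperp α, inner ℂ v (extend D u) = inner ℂ v (M φ u) :=
      fun u hu v hv => inner_extend_dualTT D hφ hu hv
    have kθ : ∀ {u}, u ∈ thetaH2 θ → u ∈ Kperp θ := fun h => thetaH2_le_Kperp θ h
    have kα : ∀ {u}, u ∈ thetaH2 α → u ∈ Kperp α := fun h => thetaH2_le_Kperp α h
    have kθ' : ∀ {u}, u ∈ H2minus → u ∈ Kperp θ := fun h => H2minus_le_Kperp θ h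
    have kα' : ∀ {u}, u ∈ H2minus → u ∈ Kperp α := fun h => H2minus_le_Kperp α h
    refine ⟨fun u hu v hv => ?_, fun f hf g hg => ?_, ⟨fun u hu g hg => ?_, fun g hg v hv => ?_⟩,
      fun g hg => ?_, fun g hg => ?_⟩
    · rw [key _ (kθ hu) _ (kα hv), key _ (kθ (M_z_mem_thetaH2 hu)) _ (kα (M_z_mem_thetaH2 hv)),
        inner_M_z_M_M_z]
    · rw [key _ (kθ' hf) _ (kα' hg),
        key _ (kθ (M_C_mem_left hg)) _ (kα (M_C_mem θ α hf))]
      exact (inner_M_C_M_M_C φ f g).symm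
    · rw [key _ (kθ (M_z_mem_thetaH2 hu)) _ (kα' hg),
        key _ (kθ hu) _ (kα' (M_star_z_mem_H2minus hg)), M_comm φ, inner_M_right]
    · rw [key _ (kθ' hg) _ (kα (M_z_mem_thetaH2 hv)),
        key _ (kθ' (M_star_z_mem_H2minus hg)) _ (kα hv), M_comm φ, inner_M_left]
    · rw [key _ (kθ (toL2_mem_thetaH2 θ)) _ (kα' hg),
        key _ (kθ (M_M_star_mem_thetaH2_left hg)) _ (kα (toL2_mem_thetaH2 α)),
        inner_self_M_M_M_star]
    · rw [key _ (kθ' hg) _ (kα (toL2_mem_thetaH2 α)),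
        key _ (kθ (toL2_mem_thetaH2 θ)) _ (kα (M_M_star_mem_thetaH2_right hg)),
        inner_M_M_star_M_self]
  · obtain ⟨φ, rfl⟩ := exists_eq_dualTT_of_inner_eq D h1 h2 h3 h3' h4 h4'
    exact isADTTO_dualTT φ
  · obtain ⟨φ, hφ⟩ := exists_eq_dualTT_of_isADTTO D hD
    exact ⟨φ, toL2_eq_of_eq_dualTT D hφ, hφ⟩
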